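/- For a real number $\theta$ let $$\Lambda(\theta)=\frac{16}{\pi^3}\sum_{n\ge 1,\ n\text{ odd}}\frac{1}{n^3\sin(n\pi\theta)}$$ whenever all terms are defined and the series converges. Call an irrational number $\theta$ diophantine if its irrationality exponent is $2$, i.e. if $2$ is the supremum of the set of real $\mu$ such that $0<|\theta-\frac qp|<p^{-\mu}$ for infinitely many coprime integer pairs $(p,q)$ with $p>0$. Let $\theta\in\mathbb{R}$ be either diophantine or a rational number whose denominator in lowest terms is even. Then the series defining $\Lambda(\theta)$ and $\Lambda(\theta+1)$ converge (absolutely, with no vanishing denominator), and $$\Lambda(\theta+1)=-\Lambda(\theta).$$ If moreover $\theta\neq-\frac12$, then the series defining $\Lambda\bigl(\frac{\theta}{2\theta+1}\bigr)$ also converges in this sense, and $$\Lambda\Bigl(\frac{\theta}{2\theta+1}\Bigr)(2\theta+1)^2-\Lambda(\theta)=2\theta^2+2\theta+1.$$ -/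

import Mathlib

/-- The irrationality exponent of a real number `θ`: the supremum, in the extended reals, of all
real `μ` such that `0 < |θ - q / p| < 1 / p ^ μ` for infinitely many coprime integer pairs `(p, q)`
with `p > 0`. -/
noncomputable def irrationalityExponent (θ : ℝ) : EReal :=
  sSup ((fun μ : ℝ => (μ : EReal)) ''
    {μ : ℝ | {pq : ℤ × ℤ | 0 < pq.1 ∧ IsCoprime pq.1 pq.2 ∧
      0 < |θ - (pq.2 : ℝ) / (pq.1 : ℝ)| ∧
      |θ - (pq.2 : ℝ) / (pq.1 : ℝ)| < 1 / (pq.1 : ℝ) ^ μ}.Infinite})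

/-- A diophantine number is an irrational number whose irrationality exponent is `2`. (Rational
numbers have irrationality exponent `1`, so irrationality excludes nothing more.) -/
def IsDiophantine (θ : ℝ) : Prop :=
  Irrational θ ∧ irrationalityExponent θ = 2

/-- `θ` is a rational number whose denominator in lowest terms is even. -/
def IsRationalWithEvenDenominator (θ : ℝ) : Prop :=
  ∃ r : ℚ, Even r.den ∧ (r : ℝ) = θ

/-- The term of index `n = 2 * k + 1` of the series `∑ 1 / (n ^ 3 * sin (n π θ))`. -/
noncomputable def lambdaTerm (θ : ℝ) (k : ℕ) : ℝ :=
  1 / ((2 * (k : ℝ) + 1) ^ 3 * Real.sin ((2 * (k : ℝ) + 1) * Real.pi * θ))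

/-- All terms of the series defining `Λ(θ)` are defined (no denominator vanishes), and the series
converges (absolutely). -/
def LambdaConverges (θ : ℝ) : Prop :=
  (∀ k : ℕ, Real.sin ((2 * (k : ℝ) + 1) * Real.pi * θ) ≠ 0) ∧ Summable (lambdaTerm θ)

/-- `Λ(θ) = (16 / π ^ 3) * ∑ 1 / (n ^ 3 * sin (n π θ))`, the sum being over odd `n ≥ 1`. -/
noncomputable def Lambda (θ : ℝ) : ℝ :=
  16 / Real.pi ^ 3 * ∑' k : ℕ, lambdaTerm θ k

open Filter Topology

/-! The shift by `1` is immediate, since sin(nπ(θ+1)) = -sin(nπθ) for odd n. For the other relation,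
expand each cosecant in partial fractions: apart from the term 1/x, which contributes a multiple of
Σ 1/n⁴, this turns Λ(θ) into a double sum over odd n and m ≥ 1 of (-1)^m/(n²D) with D = (nθ)² - m².
Since θ²/(m²D) = 1/(n²D) + 1/(n²m²), the factor n² can be traded for m² at the cost of an explicit
product of zeta-type sums. Summing over n first then gives π tan(πm/(2θ))/2, here `oddPoleSum (m /
θ)`, which has period 2 in m/θ. The map θ ↦ θ/(2θ+1) sends m/θ to m/θ + 2m, so these values do not
change, and the prefactor θ² in `OddDistBound.Lambda_eq` absorbs (2θ+1)². Only θ/3 + 1/(6θ) is left,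
and it produces the polynomial. The interchange of summations needs absolute convergence, which
follows from a lower bound on the distance from nθ to the integers for odd n (`OddDistBound`). Both
classes of θ satisfy this bound, and θ ↦ θ/(2θ+1) preserves it. -/

/-! ### Partial fractions of cotangent and cosecant -/

theorem hasSum_pi_mul_cot_sub {x : ℝ} (hx : ∀ m : ℤ, x ≠ m) :
    HasSum (fun n : ℕ => 2 * x / (x ^ 2 - ((n : ℝ) + 1) ^ 2))
      (Real.pi * (Real.cos (Real.pi * x) / Real.sin (Real.pi * x)) - 1 / x) := by
  have hz : (x : ℂ) ∈ Complex.integerComplement := by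
    rw [Complex.mem_integerComplement_iff]
    rintro ⟨m, hm⟩
    exact hx m (by exact_mod_cast hm.symm)
  have h := (summable_cotTerm hz).hasSum
  have h2 := cot_series_rep' hz
  rw [← Complex.hasSum_ofReal]
  convert h using 1
  · ext n
    rw [cotTerm_identity hz]
    push_cast
    rw [mul_one_div]
    congr 1
    ring
  · rw [show (∑' n, cotTerm (x : ℂ) n) =
      ∑' n : ℕ, (1 / ((x : ℂ) - (n + 1)) + 1 / ((x : ℂ) + (n + 1))) from rfl, ← h2, Complex.cot]
    push_cast
    rfl

theorem sin_pi_mul_ne_zero_of_forall_ne_int {x : ℝ} (hx : ∀ m : ℤ, x ≠ m) :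
    Real.sin (Real.pi * x) ≠ 0 := by
  rw [Real.sin_ne_zero_iff]
  intro m hm
  apply hx m
  have := Real.pi_ne_zero
  rw [mul_comm] at hm
  exact (mul_left_cancel₀ this hm).symm

/-- The partial fraction expansion of the cosecant. -/
theorem hasSum_pi_div_sin_sub {x : ℝ} (hx : ∀ m : ℤ, x ≠ m) :
    HasSum (fun n : ℕ => (-1) ^ (n + 1) * (2 * x / (x ^ 2 - ((n : ℝ) + 1) ^ 2)))
      (Real.pi / Real.sin (Real.pi * x) - 1 / x) := by
  have hx2 : ∀ m : ℤ, x / 2 ≠ m := by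
    intro m hm
    apply hx (2 * m)
    push_cast
    linarith
  have hx0 : x ≠ 0 := by simpa using hx 0
  have hC := hasSum_pi_mul_cot_sub hx
  have hE := (hasSum_pi_mul_cot_sub hx2).mul_left (1 / 2)
  set g : ℕ → ℝ := fun n => 2 * x / (x ^ 2 - ((n : ℝ) + 1) ^ 2) with hg
  -- The poles at even integers form half the cotangent series at x/2. Index n stands for the pole n
  -- + 1, so these are the odd indices; flipping the sign of the others amounts to π/sin πx = π
  -- cot(πx/2) - π cot πx.
  have hE' : HasSum (fun k => g (2 * k + 1)) (1 / 2 * (Real.pi *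
      (Real.cos (Real.pi * (x / 2)) / Real.sin (Real.pi * (x / 2))) - 1 / (x / 2))) := by
    refine Eq.subst (motive := fun f => HasSum f _) (funext fun k => ?_) hE
    simp only [hg]
    push_cast
    rw [eq_comm, show x ^ 2 - (2 * (k : ℝ) + 1 + 1) ^ 2 = 4 * ((x / 2) ^ 2 - ((k : ℝ) + 1) ^ 2) by ring,
      mul_div_mul_comm]
    ring
  have hO : Summable (fun k => g (2 * k)) :=
    hC.summable.comp_injective (mul_right_injective₀ two_ne_zero)
  have hO' := hO.hasSum
  have key := (hO'.even_add_odd hE').unique hC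
  have hA : HasSum (fun n => (-1) ^ (n + 1) * g n) (-(∑' k, g (2 * k)) + _) :=
    HasSum.even_add_odd (f := fun n => (-1) ^ (n + 1) * g n) (by
      simpa [pow_succ, pow_mul] using hO'.neg) (by
      simpa [pow_succ, pow_mul] using hE')
  convert hA using 1
  rw [eq_sub_of_add_eq key]
  have hs := sin_pi_mul_ne_zero_of_forall_ne_int hx
  have hs2 := sin_pi_mul_ne_zero_of_forall_ne_int hx2
  have e : Real.pi * x = 2 * (Real.pi * (x / 2)) := by ring
  rw [e, Real.sin_two_mul] at hs ⊢
  rw [Real.cos_two_mul]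
  have hc : Real.cos (Real.pi * (x / 2)) ≠ 0 := fun h => hs (by rw [h, mul_zero])
  generalize Real.cos (Real.pi * (x / 2)) = c at *
  generalize Real.sin (Real.pi * (x / 2)) = s at *
  field_simp
  ring

/-! ### The periodic pole sum -/

/-- A conditionally arranged sum equal to `(π / 2) tan (π y / 2)`. -/
noncomputable def oddPoleSum (y : ℝ) : ℝ :=
  ∑' k : ℕ, (1 / (2 * (k : ℝ) + 1 - y) - 1 / (2 * (k : ℝ) + 1 + y))

theorem summable_oddPoleSum (y : ℝ) :
    Summable fun k : ℕ => 1 / (2 * (k : ℝ) + 1 - y) - 1 / (2 * (k : ℝ) + 1 + y) := by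
  have hs : Summable fun k : ℕ => 8 * |y| * (1 / ((k : ℝ) + 1) ^ 2) := by
    refine Summable.mul_left _ ?_
    have := (summable_nat_add_iff 1).2 (Real.summable_one_div_nat_pow.2 one_lt_two)
    simpa using this
  refine Summable.of_norm_bounded_eventually_nat hs ?_
  filter_upwards [eventually_ge_atTop ⌈|y|⌉₊] with k hk
  have hk' : |y| ≤ k := Nat.ceil_le.1 hk
  obtain ⟨h1, h2⟩ := abs_le.1 hk'
  have p1 : (k : ℝ) + 1 ≤ 2 * k + 1 - y := by linarith
  have p2 : (k : ℝ) + 1 ≤ 2 * k + 1 + y := by linarith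
  have p0 : (0 : ℝ) < k + 1 := by positivity
  rw [div_sub_div _ _ (by linarith) (by linarith), Real.norm_eq_abs, abs_div,
    show 1 * (2 * (k : ℝ) + 1 + y) - (2 * (k : ℝ) + 1 - y) * 1 = 2 * y by ring, abs_mul,
    mul_one_div, abs_of_pos (show (0 : ℝ) < 2 by norm_num),
    abs_of_pos (a := (2 * (k : ℝ) + 1 - y) * _) (mul_pos (by linarith) (by linarith))]
  have : ((k : ℝ) + 1) ^ 2 ≤ (2 * (k : ℝ) + 1 - y) * (2 * (k : ℝ) + 1 + y) := by
    rw [sq]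
    gcongr
    linarith
  gcongr
  norm_num

/-- Telescoping: the N-th partial sums at y and y + 2 differ by two boundary terms that tend to 0.
With 1/0 = 0 this holds at the poles too. -/
theorem oddPoleSum_add_two (y : ℝ) : oddPoleSum (y + 2) = oddPoleSum y := by
  refine tendsto_nhds_unique (summable_oddPoleSum (y + 2)).hasSum.tendsto_sum_nat ?_
  have h := (summable_oddPoleSum y).hasSum.tendsto_sum_nat
  have hlim (z : ℝ) : Tendsto (fun N : ℕ => 1 / (2 * (N : ℝ) + z)) atTop (𝓝 0) := by
    simp_rw [one_div]
    refine tendsto_inv_atTop_zero.comp ?_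
    refine tendsto_atTop_add_const_right _ _ ?_
    exact tendsto_natCast_atTop_atTop.const_mul_atTop two_pos
  have h' := (h.sub (hlim (-1 - y))).sub (hlim (1 + y))
  rw [sub_zero, sub_zero] at h'
  refine h'.congr fun N => ?_
  induction N with
  | zero =>
    simp
    rw [show -1 - y = -(1 + y) by ring, inv_neg]
    ring
  | succ N ih =>
    rw [Finset.sum_range_succ, Finset.sum_range_succ, ← ih]
    generalize ∑ i ∈ Finset.range N, (1 / (2 * (i : ℝ) + 1 - y) - 1 / (2 * (i : ℝ) + 1 + y)) = S
    push_cast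
    ring_nf

theorem oddPoleSum_add_two_mul_nat (y : ℝ) (m : ℕ) : oddPoleSum (y + 2 * m) = oddPoleSum y := by
  induction m with
  | zero => simp
  | succ m ih =>
    rw [← ih, ← oddPoleSum_add_two (y + 2 * m)]
    push_cast
    ring_nf

/-! ### Diophantine lower bounds -/

/-- The distance from `n θ` to the nearest integer is at least `c / n ^ (3 / 2)` for all odd `n`. -/
def OddDistBound (θ : ℝ) : Prop :=
  ∃ c > 0, ∀ (k : ℕ) (m : ℤ),
    c ≤ |(2 * (k : ℝ) + 1) * θ - m| * (2 * (k : ℝ) + 1) ^ (3 / 2 : ℝ)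

theorem OddDistBound.ne_int {θ : ℝ} (h : OddDistBound θ) (k : ℕ) (m : ℤ) :
    (2 * (k : ℝ) + 1) * θ ≠ m := by
  obtain ⟨c, hc, h⟩ := h
  intro e
  have := h k m
  rw [e, sub_self, abs_zero, zero_mul] at this
  linarith

theorem OddDistBound.ne_zero {θ : ℝ} (h : OddDistBound θ) : θ ≠ 0 := by
  rintro rfl
  simpa using h.ne_int 0 0

theorem IsRationalWithEvenDenominator.oddDistBound {θ : ℝ}
    (h : IsRationalWithEvenDenominator θ) : OddDistBound θ := by
  obtain ⟨r, hr, rfl⟩ := h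
  have hd : (0 : ℝ) < r.den := by exact_mod_cast r.den_pos
  refine ⟨1 / r.den, by positivity, fun k m => ?_⟩
  have h1 : (1 : ℝ) ≤ (2 * (k : ℝ) + 1) ^ (3 / 2 : ℝ) :=
    Real.one_le_rpow (by linarith [(Nat.cast_nonneg k : (0 : ℝ) ≤ k)]) (by norm_num)
  -- Parity: the denominator is even, so the numerator and its odd multiples are odd.
  have hne : (2 * (k : ℤ) + 1) * r.num - m * r.den ≠ 0 := by
    intro e
    have h2 : (2 : ℤ) ∣ r.den := by exact_mod_cast hr.two_dvd
    have h3 : (2 : ℤ) ∣ (2 * (k : ℤ) + 1) * r.num := by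
      rw [sub_eq_zero.1 e]
      exact Dvd.dvd.mul_left h2 m
    have h4 : (2 : ℤ) ∣ r.num := by
      rcases Int.prime_two.dvd_or_dvd h3 with h | h
      · omega
      · exact h
    have h5 := Nat.dvd_gcd (Int.natAbs_dvd_natAbs.2 h4) hr.two_dvd
    rw [r.reduced.gcd_eq_one] at h5
    norm_num at h5
  have h2 : (1 : ℝ) ≤ |(2 * (k : ℝ) + 1) * r.num - m * r.den| := by
    exact_mod_cast Int.one_le_abs hne
  have h3 : (2 * (k : ℝ) + 1) * (r : ℝ) - m =
      ((2 * (k : ℝ) + 1) * r.num - m * r.den) / r.den := by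
    rw [Rat.cast_def]
    field_simp
  rw [h3, abs_div, abs_of_pos hd]
  calc 1 / (r.den : ℝ) ≤ |(2 * (k : ℝ) + 1) * r.num - m * r.den| / r.den := by gcongr
    _ ≤ _ := le_mul_of_one_le_right (by positivity) h1

theorem IsDiophantine.finite_setOf_near {θ : ℝ} (h : IsDiophantine θ) {μ : ℝ} (hμ : 2 < μ) :
    {pq : ℤ × ℤ | 0 < pq.1 ∧ IsCoprime pq.1 pq.2 ∧
      |θ - (pq.2 : ℝ) / (pq.1 : ℝ)| < 1 / (pq.1 : ℝ) ^ μ}.Finite := by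
  have hn : ¬ {pq : ℤ × ℤ | 0 < pq.1 ∧ IsCoprime pq.1 pq.2 ∧
      0 < |θ - (pq.2 : ℝ) / (pq.1 : ℝ)| ∧
      |θ - (pq.2 : ℝ) / (pq.1 : ℝ)| < 1 / (pq.1 : ℝ) ^ μ}.Infinite := by
    intro hi
    have : (μ : EReal) ≤ irrationalityExponent θ := le_sSup ⟨μ, hi, rfl⟩
    rw [h.2] at this
    have h2 : (μ : EReal) ≤ ((2 : ℝ) : EReal) := this
    rw [EReal.coe_le_coe_iff] at h2
    linarith
  refine (Set.not_infinite.1 hn).subset fun pq hpq => ⟨hpq.1, hpq.2.1, ?_, hpq.2.2⟩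
  rw [abs_pos, sub_ne_zero]
  intro e
  exact h.1 ⟨(pq.2 : ℚ) / (pq.1 : ℚ), by rw [e]; push_cast; rfl⟩

theorem IsDiophantine.oddDistBound {θ : ℝ} (h : IsDiophantine θ) : OddDistBound θ := by
  -- Any exponent strictly between 2 and 3 would serve: above 2 for finiteness, below 3 for the
  -- later convergence. The constant c is a minimum over the finitely many exceptional fractions,
  -- capped at 1.
  have hf := h.finite_setOf_near (μ := 5 / 2) (by norm_num)
  have hir (p q : ℤ) (hp : 0 < p) : |θ - (q : ℝ) / (p : ℝ)| ≠ 0 := by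
    rw [abs_ne_zero, sub_ne_zero]
    intro e
    exact h.1 ⟨(q : ℚ) / (p : ℚ), by rw [e]; push_cast; rfl⟩
  obtain ⟨c, hc, hcb⟩ : ∃ c > 0, ∀ p q : ℤ, 0 < p → IsCoprime p q →
      c ≤ |θ - (q : ℝ) / (p : ℝ)| * (p : ℝ) ^ (5 / 2 : ℝ) := by
    obtain ⟨c, hc, hcb⟩ : ∃ c > 0, ∀ pq ∈ hf.toFinset,
        c ≤ |θ - (pq.2 : ℝ) / (pq.1 : ℝ)| * (pq.1 : ℝ) ^ (5 / 2 : ℝ) := by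
      rcases hf.toFinset.eq_empty_or_nonempty with he | hne
      · exact ⟨1, one_pos, fun pq hpq => absurd hpq (by simp only [he, Finset.notMem_empty, not_false_eq_true])⟩
      · obtain ⟨x, hx, hmin⟩ := hf.toFinset.exists_min_image
          (fun pq => |θ - (pq.2 : ℝ) / (pq.1 : ℝ)| * (pq.1 : ℝ) ^ (5 / 2 : ℝ)) hne
        have hx1 : 0 < x.1 := ((hf.mem_toFinset).1 hx).1
        have hx2 : (0 : ℝ) < x.1 := by exact_mod_cast hx1
        refine ⟨_, ?_, hmin⟩
        have := (abs_nonneg _).lt_of_ne' (hir x.1 x.2 hx1)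
        positivity
    refine ⟨min c 1, by positivity, fun p q hp hpq => ?_⟩
    by_cases hm : (p, q) ∈ hf.toFinset
    · exact (min_le_left _ _).trans (hcb _ hm)
    · refine (min_le_right _ _).trans ?_
      rw [hf.mem_toFinset] at hm
      have hp' : (0 : ℝ) < p := by exact_mod_cast hp
      have : 1 / (p : ℝ) ^ (5 / 2 : ℝ) ≤ |θ - (q : ℝ) / (p : ℝ)| :=
        not_lt.1 fun hlt => hm ⟨hp, hpq, hlt⟩
      rwa [div_le_iff₀ (by positivity)] at this
  refine ⟨c, hc, fun k m => ?_⟩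
  have hn : (0 : ℤ) < 2 * k + 1 := by positivity
  set n : ℤ := 2 * k + 1 with hn_def
  have hcast : (2 * (k : ℝ) + 1) = (n : ℝ) := by rw [hn_def]; push_cast; rfl
  rw [hcast]
  have hg : 0 < Int.gcd n m := Int.gcd_pos_of_ne_zero_left m hn.ne'
  -- Cancelling the gcd can only shrink both factors of the bound.
  obtain ⟨g, n', m', hg0, hcop, hn', hm'⟩ := Int.exists_gcd_one' hg
  have hg1 : (1 : ℝ) ≤ g := by exact_mod_cast hg0
  have hn'0 : 0 < n' := by
    rw [hn'] at hn
    exact pos_of_mul_pos_left hn (by positivity)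
  have hp' : (0 : ℝ) < n' := by exact_mod_cast hn'0
  refine (hcb n' m' hn'0 (Int.isCoprime_iff_gcd_eq_one.2 hcop)).trans ?_
  have e1 : (n : ℝ) * θ - m = g * ((n' : ℝ) * (θ - m' / n')) := by
    rw [hn', hm']
    push_cast
    field_simp
  rw [e1, abs_mul, abs_mul, abs_of_pos hp', abs_of_pos (by linarith : (0 : ℝ) < g),
    show (5 / 2 : ℝ) = 3 / 2 + 1 by norm_num, Real.rpow_add_one hp'.ne']
  have e2 : (n' : ℝ) ^ (3 / 2 : ℝ) ≤ (n : ℝ) ^ (3 / 2 : ℝ) := by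
    refine Real.rpow_le_rpow hp'.le ?_ (by norm_num)
    rw [hn']
    push_cast
    nlinarith
  calc |θ - m' / n'| * ((n' : ℝ) ^ (3 / 2 : ℝ) * n')
      = 1 * (n' * |θ - m' / n'|) * (n' : ℝ) ^ (3 / 2 : ℝ) := by ring
    _ ≤ _ := by gcongr

/-- For t = θ/(2θ+1), one has (2θ+1)(nt - m) = (n - 2m)θ - m, and n - 2m is again odd. When |nt - m|
< 1, it is at most a constant times n in absolute value. -/
theorem OddDistBound.div_two_mul_add_one {θ : ℝ} (h : OddDistBound θ) (hθ : θ ≠ -1 / 2) :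
    OddDistBound (θ / (2 * θ + 1)) := by
  obtain ⟨c, hc, h⟩ := h
  have hd : 2 * θ + 1 ≠ 0 := fun e => hθ (by linarith)
  have hd' : 0 < |2 * θ + 1| := abs_pos.2 hd
  set t := θ / (2 * θ + 1) with ht
  set A : ℝ := 2 * |t| + 3 with hA
  have hA0 : 0 < A := by positivity
  refine ⟨min 1 (c / (|2 * θ + 1| * A ^ (3 / 2 : ℝ))), by positivity, fun k m => ?_⟩
  have hk : (0 : ℝ) ≤ k := k.cast_nonneg
  have h1 : (1 : ℝ) ≤ (2 * (k : ℝ) + 1) ^ (3 / 2 : ℝ) :=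
    Real.one_le_rpow (by linarith) (by norm_num)
  rcases le_or_gt 1 |(2 * (k : ℝ) + 1) * t - m| with hbig | hsmall
  · exact (min_le_left _ _).trans (one_le_mul_of_one_le_of_one_le hbig h1)
  refine (min_le_right _ _).trans ?_
  obtain ⟨j, M, hj, hM⟩ : ∃ (j : ℕ) (M : ℤ),
      (2 * (j : ℝ) + 1) = |2 * (k : ℝ) + 1 - 2 * m| ∧
      |(2 * (j : ℝ) + 1) * θ - M| = |(2 * (k : ℝ) + 1 - 2 * m) * θ - m| := by
    rcases le_or_gt m k with hmk | hmk
    · obtain ⟨j, hj⟩ := Int.eq_ofNat_of_zero_le (sub_nonneg.2 hmk)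
      have hj' : (k : ℝ) - m = j := by exact_mod_cast hj
      have hj0 : (0 : ℝ) ≤ j := j.cast_nonneg
      refine ⟨j, m, ?_, ?_⟩
      · rw [abs_of_nonneg (by linarith)]; linarith
      · rw [← hj']; ring_nf
    · obtain ⟨j, hj⟩ := Int.eq_ofNat_of_zero_le (show 0 ≤ m - k - 1 by omega)
      have hj' : (m : ℝ) - k - 1 = j := by exact_mod_cast hj
      have hj0 : (0 : ℝ) ≤ j := j.cast_nonneg
      refine ⟨j, -m, ?_, ?_⟩
      · rw [abs_of_nonpos (by linarith)]; linarith
      · rw [← abs_neg, ← hj']; push_cast; ring_nf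
  have hb := h j M
  rw [hM] at hb
  have e1 : (2 * (k : ℝ) + 1 - 2 * m) * θ - m = (2 * θ + 1) * ((2 * (k : ℝ) + 1) * t - m) := by
    rw [ht]
    field_simp
    ring
  have hjA : 2 * (j : ℝ) + 1 ≤ A * (2 * (k : ℝ) + 1) := by
    rw [hj]
    have e2 : 2 * (k : ℝ) + 1 - 2 * m =
        2 * ((2 * (k : ℝ) + 1) * t - m) + (2 * (k : ℝ) + 1) * (1 - 2 * t) := by ring
    have e3 : |1 - 2 * t| ≤ 1 + 2 * |t| := by
      have := abs_sub (1 : ℝ) (2 * t)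
      rwa [abs_one, abs_mul, abs_two] at this
    calc |2 * (k : ℝ) + 1 - 2 * m|
        ≤ |2 * ((2 * (k : ℝ) + 1) * t - m)| + |(2 * (k : ℝ) + 1) * (1 - 2 * t)| := by
          rw [e2]; exact abs_add_le _ _
      _ = 2 * |(2 * (k : ℝ) + 1) * t - m| + (2 * (k : ℝ) + 1) * |1 - 2 * t| := by
          rw [abs_mul, abs_mul, abs_two, abs_of_pos (by linarith : (0 : ℝ) < 2 * (k : ℝ) + 1)]
      _ ≤ 2 * 1 + (2 * (k : ℝ) + 1) * (1 + 2 * |t|) := by gcongr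
      _ ≤ A * (2 * (k : ℝ) + 1) := by rw [hA]; nlinarith
  rw [div_le_iff₀ (by positivity)]
  calc c ≤ _ := hb
    _ ≤ |(2 * (k : ℝ) + 1 - 2 * m) * θ - m| * (A * (2 * (k : ℝ) + 1)) ^ (3 / 2 : ℝ) := by
      gcongr
    _ = _ := by
      rw [e1, abs_mul, Real.mul_rpow hA0.le (by positivity)]
      ring

/-! ### Estimates and special values for the double series -/

/-- Only the integer nearest to |t| needs the hypothesis on δ. Any other m lies at distance at least
half of |m - round |t||, which gives quadratic growth. -/
theorem one_add_sq_le_of_dist {δ T : ℝ} {t : ℝ} (hδ : 0 < δ) (hT : 0 < T) (hT' : T ≤ |t|)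
    (hδT : δ * T ≤ 1) (ht : ∀ m : ℤ, δ ≤ |t - m|) (m : ℤ) (hm : 0 < m) :
    δ * T / 8 * (1 + ((m : ℝ) - round |t|) ^ 2) ≤ |t ^ 2 - (m : ℝ) ^ 2| := by
  have hm' : (0 : ℝ) < m := by exact_mod_cast hm
  have h1 : δ ≤ |(|t| - m)| := by
    rcases abs_choice t with h | h
    · rw [h]; exact ht m
    · rw [h, ← abs_neg]
      have := ht (-m)
      push_cast at this
      convert this using 2
      ring
  have e : |t ^ 2 - (m : ℝ) ^ 2| = |(|t| - m)| * (|t| + m) := by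
    rw [← sq_abs t, sq_sub_sq, abs_mul, abs_of_pos (a := |t| + m) (by linarith), mul_comm]
  rw [e]
  set s := |t|
  by_cases hr : m = round s
  · rw [hr, sub_self]
    have : δ * T ≤ |s - (round s : ℤ)| * (s + (round s : ℤ)) := by
      rw [← hr]
      gcongr
      linarith
    have h0 : 0 < δ * T := by positivity
    nlinarith
  · have h2 : (1 : ℝ) ≤ |(m : ℝ) - round s| := by
      exact_mod_cast Int.one_le_abs (sub_ne_zero.2 hr)
    have h3 : |s - round s| ≤ 1 / 2 := abs_sub_round s
    have h4 : |(m : ℝ) - round s| ≤ |s - m| + |s - round s| := by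
      have := abs_sub_le (m : ℝ) s (round s)
      rwa [abs_sub_comm (m : ℝ) s] at this
    have h5 : |(m : ℝ) - round s| / 2 ≤ |s - m| := by linarith
    have h6 : |s - m| ≤ s + m := by
      rw [abs_le]
      constructor <;> linarith [abs_nonneg t]
    have h7 : 1 ≤ ((m : ℝ) - round s) ^ 2 := by
      rw [← sq_abs]; nlinarith
    calc δ * T / 8 * (1 + ((m : ℝ) - round s) ^ 2)
        ≤ 1 / 8 * (((m : ℝ) - round s) ^ 2 + ((m : ℝ) - round s) ^ 2) := by gcongr
      _ = (|(m : ℝ) - round s| / 2) * (|(m : ℝ) - round s| / 2) := by rw [← sq_abs]; ring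
      _ ≤ |s - m| * (s + m) := by gcongr; linarith

theorem HasSum.congr_eq {ι : Type*} {f g : ι → ℝ} {a b : ℝ} (h : HasSum f a)
    (hfg : ∀ i, g i = f i) (hab : b = a) : HasSum g b := by
  rw [funext hfg, hab]
  exact h

theorem summable_inv_one_add_int_sq : Summable fun l : ℤ => (1 + (l : ℝ) ^ 2)⁻¹ := by
  refine Summable.of_norm_bounded_eventually (Real.summable_one_div_int_pow.2 one_lt_two) ?_
  filter_upwards [eventually_cofinite_ne (0 : ℤ)] with l hl
  have : (0 : ℝ) < (l : ℝ) ^ 2 := by positivity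
  rw [Real.norm_of_nonneg (by positivity), ← one_div]
  gcongr
  linarith

theorem hasSum_one_div_odd_pow {d : ℕ} {s : ℝ}
    (h : HasSum (fun n : ℕ => (1 : ℝ) / (n : ℝ) ^ d) s) :
    HasSum (fun k : ℕ => 1 / (2 * (k : ℝ) + 1) ^ d) (s - 1 / 2 ^ d * s) := by
  have he : HasSum (fun k : ℕ => (1 : ℝ) / ((2 * k : ℕ) : ℝ) ^ d) (1 / 2 ^ d * s) := by
    refine (h.mul_left (1 / 2 ^ d)).congr_eq (fun k => ?_) rfl
    push_cast
    rw [mul_pow, div_mul_div_comm, one_mul]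
  have ho : Summable (fun k : ℕ => (1 : ℝ) / ((2 * k + 1 : ℕ) : ℝ) ^ d) :=
    h.summable.comp_injective (i := fun k : ℕ => 2 * k + 1) fun a b hab => by simpa using hab
  have key := (HasSum.even_add_odd (f := fun n : ℕ => (1 : ℝ) / (n : ℝ) ^ d) he ho.hasSum).unique h
  have := ho.hasSum
  rw [eq_sub_of_add_eq' key] at this
  simpa using this

theorem hasSum_one_div_odd_sq :
    HasSum (fun k : ℕ => 1 / (2 * (k : ℝ) + 1) ^ 2) (Real.pi ^ 2 / 8) := by
  convert hasSum_one_div_odd_pow hasSum_zeta_two using 1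
  ring

theorem hasSum_one_div_odd_pow_four :
    HasSum (fun k : ℕ => 1 / (2 * (k : ℝ) + 1) ^ 4) (Real.pi ^ 4 / 96) := by
  convert hasSum_one_div_odd_pow hasSum_zeta_four using 1
  ring

theorem hasSum_neg_one_pow_div_sq :
    HasSum (fun j : ℕ => (-1) ^ (j + 1) / ((j : ℝ) + 1) ^ 2) (-(Real.pi ^ 2 / 12)) := by
  have h1 : HasSum (fun k : ℕ => -(1 / (2 * (k : ℝ) + 1) ^ 2)) (-(Real.pi ^ 2 / 8)) :=
    hasSum_one_div_odd_sq.neg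
  have h2 : HasSum (fun k : ℕ => 1 / 4 * (1 / ((k : ℝ) + 1) ^ 2)) (1 / 4 * (Real.pi ^ 2 / 6)) := by
    have := (hasSum_nat_add_iff' 1).2 hasSum_zeta_two
    simp only [Finset.range_one, Finset.sum_singleton, Nat.cast_zero, ne_eq, OfNat.ofNat_ne_zero,
      not_false_eq_true, zero_pow, div_zero, sub_zero, Nat.cast_add, Nat.cast_one] at this
    exact this.mul_left _
  have h3 : HasSum (fun j : ℕ => (-1) ^ (j + 1) / ((j : ℝ) + 1) ^ 2)
      (-(Real.pi ^ 2 / 8) + 1 / 4 * (Real.pi ^ 2 / 6)) := by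
    refine HasSum.even_add_odd ?_ ?_
    · refine h1.congr_eq (fun k => ?_) rfl
      simp [pow_succ, pow_mul, neg_div]
    · refine h2.congr_eq (fun k => ?_) rfl
      push_cast
      rw [show 2 * (k : ℝ) + 1 + 1 = 2 * (k + 1) by ring]
      simp only [pow_succ, pow_mul]
      norm_num
      ring
  convert h3 using 1
  ring

/-! ### The double series and its two orders of summation -/

/-- The double series whose row sums give the partial fractions of the terms of `Λ`. -/
noncomputable def crossTerm (θ : ℝ) (p : ℕ × ℕ) : ℝ :=
  (-1) ^ (p.2 + 1) / ((2 * (p.1 : ℝ) + 1) ^ 2 *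
    (((2 * (p.1 : ℝ) + 1) * θ) ^ 2 - ((p.2 : ℝ) + 1) ^ 2))

/-- The double series whose column sums give values of `oddPoleSum`. -/
noncomputable def crossTermSwap (θ : ℝ) (p : ℕ × ℕ) : ℝ :=
  (-1) ^ (p.2 + 1) / (((p.2 : ℝ) + 1) ^ 2 *
    (((2 * (p.1 : ℝ) + 1) * θ) ^ 2 - ((p.2 : ℝ) + 1) ^ 2))

theorem OddDistBound.sq_sub_sq_ne_zero {θ : ℝ} (h : OddDistBound θ) (k j : ℕ) :
    ((2 * (k : ℝ) + 1) * θ) ^ 2 - ((j : ℝ) + 1) ^ 2 ≠ 0 := by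
  intro e
  rcases sq_eq_sq_iff_eq_or_eq_neg.1 (sub_eq_zero.1 e) with e | e
  · exact h.ne_int k (j + 1) (by rw [e]; push_cast; rfl)
  · exact h.ne_int k (-(j + 1)) (by rw [e]; push_cast; rfl)

/-- Re-indexing m by its offset l from round |nθ|, the terms are dominated by a constant times
n^(-3/2)/(1 + l²), a product of two summable families. -/
theorem OddDistBound.summable_crossTerm {θ : ℝ} (h : OddDistBound θ) :
    Summable (crossTerm θ) := by
  have hθ : 0 < |θ| := abs_pos.2 h.ne_zero
  obtain ⟨c, hc, hcθ, hcb⟩ : ∃ c > 0, c * |θ| ≤ 1 ∧ ∀ (k : ℕ) (m : ℤ),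
      c ≤ |(2 * (k : ℝ) + 1) * θ - m| * (2 * (k : ℝ) + 1) ^ (3 / 2 : ℝ) := by
    obtain ⟨c, hc, hcb⟩ := h
    refine ⟨min c (1 / |θ|), by positivity, ?_, fun k m => (min_le_left _ _).trans (hcb k m)⟩
    rw [← le_div_iff₀ hθ]
    exact min_le_right _ _
  set w : ℕ → ℝ := fun k => (2 * (k : ℝ) + 1) ^ (3 / 2 : ℝ) with hw
  have hw1 (k : ℕ) : 1 ≤ w k :=
    Real.one_le_rpow (by linarith [(Nat.cast_nonneg k : (0 : ℝ) ≤ k)]) (by norm_num)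
  have hw2 (k : ℕ) : w k * w k = (2 * (k : ℝ) + 1) ^ 3 := by
    rw [hw, ← Real.rpow_add (by positivity), ← Real.rpow_natCast]
    norm_num
  have hsw : Summable fun k => (w k)⁻¹ := by
    have h1 : Summable fun n : ℕ => ((n : ℝ) ^ (3 / 2 : ℝ))⁻¹ :=
      Real.summable_nat_rpow_inv.2 (by norm_num)
    have h2 := h1.comp_injective (i := fun k : ℕ => 2 * k + 1) fun a b hab => by simpa using hab
    refine h2.congr fun k => ?_
    simp [hw]
  have hF : Summable fun q : ℕ × ℤ => (w q.1)⁻¹ * (1 + (q.2 : ℝ) ^ 2)⁻¹ :=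
    hsw.mul_of_nonneg summable_inv_one_add_int_sq
      (fun k => inv_nonneg.2 (zero_le_one.trans (hw1 k))) (fun l => by positivity)
  have hinj : Function.Injective fun p : ℕ × ℕ =>
      (p.1, (p.2 : ℤ) + 1 - round |(2 * (p.1 : ℝ) + 1) * θ|) := by
    rintro ⟨k, j⟩ ⟨k', j'⟩ e
    simp only [Prod.mk.injEq] at e
    obtain ⟨rfl, e⟩ := e
    simpa using e
  refine Summable.of_norm_bounded ((hF.comp_injective hinj).mul_left (8 / (c * |θ|))) ?_
  rintro ⟨k, j⟩
  have hn : (1 : ℝ) ≤ 2 * k + 1 := by linarith [(Nat.cast_nonneg k : (0 : ℝ) ≤ k)]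
  have hn0 : (0 : ℝ) < 2 * k + 1 := by linarith
  have hw0 : 0 < w k := one_pos.trans_le (hw1 k)
  -- The small divisor costs n^(3/2), but the available power n³ still leaves n^(3/2).
  have hT : c / w k * ((2 * (k : ℝ) + 1) * |θ|) * (2 * (k : ℝ) + 1) ^ 2 = c * |θ| * w k := by
    field_simp
    rw [← hw2]
    ring
  have hwn : 2 * (k : ℝ) + 1 ≤ w k := by
    conv_lhs => rw [← Real.rpow_one (2 * (k : ℝ) + 1)]
    exact Real.rpow_le_rpow_of_exponent_le hn (by norm_num)
  have key := one_add_sq_le_of_dist (δ := c / w k) (T := (2 * (k : ℝ) + 1) * |θ|)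
    (t := (2 * (k : ℝ) + 1) * θ) (by positivity) (by positivity)
    (by rw [abs_mul, abs_of_pos hn0]) (by
      calc c / w k * ((2 * (k : ℝ) + 1) * |θ|) = c * |θ| * ((2 * (k : ℝ) + 1) / w k) := by ring
        _ ≤ 1 * 1 := by
          gcongr
          exact (div_le_one hw0).2 hwn
        _ = 1 := one_mul 1)
    (fun m => (div_le_iff₀ hw0).2 (hcb k m)) ((j : ℤ) + 1) (by positivity)
  simp only [crossTerm, Function.comp_def]
  rw [norm_div, norm_pow, norm_neg, norm_one, one_pow, norm_mul, Real.norm_eq_abs,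
    Real.norm_eq_abs, abs_of_pos (a := (2 * (k : ℝ) + 1) ^ 2) (by positivity)]
  push_cast at key ⊢
  set l : ℝ := (j : ℝ) + 1 - round |(2 * (k : ℝ) + 1) * θ|
  rw [← mul_inv, div_mul_eq_mul_div, ← div_eq_mul_inv, div_div]
  have h2 : w k * (1 + l ^ 2) * (c * |θ|) / 8 ≤
      (2 * (k : ℝ) + 1) ^ 2 * |((2 * (k : ℝ) + 1) * θ) ^ 2 - ((j : ℝ) + 1) ^ 2| := by
    calc _ = (2 * (k : ℝ) + 1) ^ 2 *
          (c / w k * ((2 * (k : ℝ) + 1) * |θ|) / 8 * (1 + l ^ 2)) := by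
          linear_combination (-(1 + l ^ 2) / 8) * hT
      _ ≤ _ := by gcongr
  refine (one_div_le_one_div_of_le (by positivity) h2).trans_eq ?_
  field_simp

theorem OddDistBound.hasSum_lambdaTerm {θ : ℝ} (h : OddDistBound θ) :
    HasSum (lambdaTerm θ)
      (2 * θ / Real.pi * ((∑' p, crossTerm θ p) + Real.pi ^ 4 / (192 * θ ^ 2))) := by
  have hθ := h.ne_zero
  have h1 : HasSum (fun k => Real.pi / (2 * θ) * lambdaTerm θ k -
      1 / (2 * θ ^ 2) * (1 / (2 * (k : ℝ) + 1) ^ 4)) (∑' p, crossTerm θ p) := by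
    refine h.summable_crossTerm.hasSum.prod_fiberwise fun k => ?_
    have hx : (2 * (k : ℝ) + 1) * θ ≠ 0 := by simpa using h.ne_int k 0
    have hn : (2 * (k : ℝ) + 1) ≠ 0 := by positivity
    have := (hasSum_pi_div_sin_sub (h.ne_int k)).mul_left
      (1 / (2 * ((2 * (k : ℝ) + 1) * θ) * (2 * (k : ℝ) + 1) ^ 2))
    refine this.congr_eq (fun j => ?_) ?_
    · have hz := h.sq_sub_sq_ne_zero k j
      simp only [crossTerm]
      field_simp
    · have hs := sin_pi_mul_ne_zero_of_forall_ne_int (h.ne_int k)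
      simp only [lambdaTerm]
      rw [show (2 * (k : ℝ) + 1) * Real.pi * θ = Real.pi * ((2 * (k : ℝ) + 1) * θ) by ring]
      field_simp
  have h2 := ((h1.add (hasSum_one_div_odd_pow_four.mul_left (1 / (2 * θ ^ 2)))).mul_left
    (2 * θ / Real.pi))
  have hpi := Real.pi_ne_zero
  refine h2.congr_eq (fun k => ?_) ?_
  · field_simp
    ring
  · field_simp
    ring

theorem OddDistBound.lambdaConverges {θ : ℝ} (h : OddDistBound θ) : LambdaConverges θ := by
  refine ⟨fun k => ?_, h.hasSum_lambdaTerm.summable⟩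
  rw [show (2 * (k : ℝ) + 1) * Real.pi * θ = Real.pi * ((2 * (k : ℝ) + 1) * θ) by ring]
  exact sin_pi_mul_ne_zero_of_forall_ne_int (h.ne_int k)

theorem OddDistBound.hasSum_crossTermSwap {θ : ℝ} (h : OddDistBound θ) :
    HasSum (crossTermSwap θ) (((∑' p, crossTerm θ p) - Real.pi ^ 4 / 96) / θ ^ 2) := by
  have hθ := h.ne_zero
  have he : HasSum (fun p : ℕ × ℕ => 1 / (2 * (p.1 : ℝ) + 1) ^ 2 *
      ((-1) ^ (p.2 + 1) / ((p.2 : ℝ) + 1) ^ 2)) (Real.pi ^ 2 / 8 * -(Real.pi ^ 2 / 12)) := by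
    have hs := summable_mul_of_summable_norm (R := ℝ) hasSum_one_div_odd_sq.summable.norm
        hasSum_neg_one_pow_div_sq.summable.norm
    exact (HasSum.mul (α := ℝ) hasSum_one_div_odd_sq hasSum_neg_one_pow_div_sq hs).congr_eq
      (fun _ => rfl) rfl
  -- This is 1/(n²D) + 1/(n²m²) = θ²/(m²D), summed over all pairs.
  have h1 := (h.summable_crossTerm.hasSum.add he).mul_left (1 / θ ^ 2)
  refine h1.congr_eq ?_ ?_
  · rintro ⟨k, j⟩
    have hz := h.sq_sub_sq_ne_zero k j
    have hn : (2 * (k : ℝ) + 1) ≠ 0 := by positivity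
    have hm : ((j : ℝ) + 1) ≠ 0 := by positivity
    simp only [crossTerm, crossTermSwap]
    generalize (2 * (k : ℝ) + 1) = n at *
    generalize (j : ℝ) + 1 = m at *
    obtain ⟨D, hD⟩ : ∃ D, D = (n * θ) ^ 2 - m ^ 2 := ⟨_, rfl⟩
    rw [← hD] at hz ⊢
    field_simp
    rw [hD]
    ring
  · ring

theorem OddDistBound.tsum_oddPoleSum {θ : ℝ} (h : OddDistBound θ) :
    ∑' j : ℕ, (-1) ^ (j + 1) / ((j : ℝ) + 1) ^ 3 * oddPoleSum (((j : ℝ) + 1) / θ) =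
      2 * θ * (((∑' p, crossTerm θ p) - Real.pi ^ 4 / 96) / θ ^ 2) := by
  have hθ := h.ne_zero
  have h1 := ((Equiv.prodComm ℕ ℕ).hasSum_iff (f := crossTermSwap θ)).2 h.hasSum_crossTermSwap
  refine HasSum.tsum_eq (HasSum.prod_fiberwise (h1.mul_left (2 * θ)) fun j => ?_)
  refine ((summable_oddPoleSum (((j : ℝ) + 1) / θ)).hasSum.mul_left _).congr_eq (fun k => ?_) rfl
  have hz := h.sq_sub_sq_ne_zero k j
  have hm : ((j : ℝ) + 1) ≠ 0 := by positivity
  simp only [crossTermSwap, Function.comp_def, Equiv.prodComm_apply, Prod.swap_prod_mk]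
  have hz' := hz
  rw [sq_sub_sq] at hz'
  have hp := left_ne_zero_of_mul hz'
  have hq := right_ne_zero_of_mul hz'
  have e1 : 2 * (k : ℝ) + 1 - ((j : ℝ) + 1) / θ = ((2 * (k : ℝ) + 1) * θ - (j + 1)) / θ := by
    field_simp
  have e2 : 2 * (k : ℝ) + 1 + ((j : ℝ) + 1) / θ = ((2 * (k : ℝ) + 1) * θ + (j + 1)) / θ := by
    field_simp
  have hpq : (2 * (k : ℝ) + 1) * θ + (j + 1) = (2 * (k : ℝ) + 1) * θ - (j + 1) + 2 * (j + 1) := by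
    ring
  rw [e1, e2, sq_sub_sq, one_div_div, one_div_div]
  rw [hpq] at hp ⊢
  generalize (2 * (k : ℝ) + 1) * θ - (j + 1) = q at *
  generalize (j : ℝ) + 1 = m at *
  field_simp
  ring

/-! ### The functional equations -/

/-- The term θ/3 comes from the product sum over 1/(n²m²), and 1/(6θ) from the poles 1/x, through Σ
1/n⁴ over odd n. -/
theorem OddDistBound.Lambda_eq {θ : ℝ} (h : OddDistBound θ) :
    Lambda θ = 16 / Real.pi ^ 4 * θ ^ 2 *
      ∑' j : ℕ, (-1) ^ (j + 1) / ((j : ℝ) + 1) ^ 3 * oddPoleSum (((j : ℝ) + 1) / θ) +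
      θ / 3 + 1 / (6 * θ) := by
  have hθ := h.ne_zero
  have hpi := Real.pi_ne_zero
  rw [Lambda, h.hasSum_lambdaTerm.tsum_eq, h.tsum_oddPoleSum]
  field_simp
  ring

theorem OddDistBound.Lambda_div_two_mul_add_one {θ : ℝ} (h : OddDistBound θ) (hθ : θ ≠ -1 / 2) :
    Lambda (θ / (2 * θ + 1)) * (2 * θ + 1) ^ 2 - Lambda θ = 2 * θ ^ 2 + 2 * θ + 1 := by
  have h0 := h.ne_zero
  have hd : 2 * θ + 1 ≠ 0 := fun e => hθ (by linarith)
  have e (j : ℕ) : oddPoleSum (((j : ℝ) + 1) / (θ / (2 * θ + 1))) =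
      oddPoleSum (((j : ℝ) + 1) / θ) := by
    -- The reciprocal of θ/(2θ+1) is 1/θ + 2, so the argument moves by j + 1 full periods.
    rw [← oddPoleSum_add_two_mul_nat (((j : ℝ) + 1) / θ) (j + 1)]
    congr 1
    push_cast
    field_simp
    ring
  rw [h.Lambda_eq, (h.div_two_mul_add_one hθ).Lambda_eq]
  simp_rw [e]
  generalize (∑' j : ℕ, (-1) ^ (j + 1) / ((j : ℝ) + 1) ^ 3 * oddPoleSum (((j : ℝ) + 1) / θ)) = Q
  have hpi := Real.pi_ne_zero
  obtain ⟨d, hd'⟩ : ∃ d, d = 2 * θ + 1 := ⟨_, rfl⟩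
  rw [← hd'] at hd ⊢
  field_simp
  rw [hd']
  ring

theorem lambdaTerm_add_one (θ : ℝ) (k : ℕ) : lambdaTerm (θ + 1) k = -lambdaTerm θ k := by
  have e : (2 * (k : ℝ) + 1) * Real.pi * (θ + 1) =
      (2 * (k : ℝ) + 1) * Real.pi * θ + Real.pi + (k : ℝ) * (2 * Real.pi) := by ring
  rw [lambdaTerm, lambdaTerm, e, Real.sin_add_nat_mul_two_pi, Real.sin_add_pi, mul_neg, div_neg]

theorem Lambda_add_one (θ : ℝ) : Lambda (θ + 1) = -Lambda θ := by
  simp_rw [Lambda, lambdaTerm_add_one, tsum_neg, mul_neg]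

theorem LambdaConverges.add_one {θ : ℝ} (h : LambdaConverges θ) : LambdaConverges (θ + 1) := by
  refine ⟨fun k => ?_, ?_⟩
  · have e : (2 * (k : ℝ) + 1) * Real.pi * (θ + 1) =
        (2 * (k : ℝ) + 1) * Real.pi * θ + Real.pi + (k : ℝ) * (2 * Real.pi) := by ring
    rw [e, Real.sin_add_nat_mul_two_pi, Real.sin_add_pi]
    exact neg_ne_zero.2 (h.1 k)
  · rw [funext (lambdaTerm_add_one θ)]
    exact h.2.neg

theorem mainTheorem3 (θ : ℝ) (hθ : IsDiophantine θ ∨ IsRationalWithEvenDenominator θ) :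
    (LambdaConverges θ ∧ LambdaConverges (θ + 1) ∧ Lambda (θ + 1) = -Lambda θ) ∧
    (θ ≠ -1 / 2 →
      LambdaConverges (θ / (2 * θ + 1)) ∧
      Lambda (θ / (2 * θ + 1)) * (2 * θ + 1) ^ 2 - Lambda θ = 2 * θ ^ 2 + 2 * θ + 1) := by
  have h : OddDistBound θ := hθ.elim (·.oddDistBound) (·.oddDistBound)
  exact ⟨⟨h.lambdaConverges, h.lambdaConverges.add_one, Lambda_add_one θ⟩, fun hne =>
    ⟨(h.div_two_mul_add_one hne).lambdaConverges, h.Lambda_div_two_mul_add_one hne⟩⟩
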